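/- Let $\Omega\subset\mathbb C$ be a $C^\infty$-smoothly bounded domain, i.e. a bounded domain which near each boundary point is given by $\{\psi<0\}$ for some smooth real function $\psi$ with nonvanishing differential. Its Carathéodory metric is $$c_\Omega(z)=\sup\{|f'(z)| : f:\Omega\to\mathbb D \text{ holomorphic},\ f(z)=0\},$$ and its Szegő metric is $$s_\Omega(z)=\sqrt{\frac{\partial^2\log S_\Omega(z,z)}{\partial z\,\partial\bar z}},$$ where the Szegő kernel $S_\Omega$ is the reproducing kernel of the Hardy space $H^2(\partial\Omega)$, the closure in $L^2(\partial\Omega)$ (with respect to arc length) of the set of boundary traces of functions that are holomorphic on $\Omega$ and smooth on $\overline\Omega$, its elements being identified with their holomorphic extensions to $\Omega$. **Theorem.** There is no universal constant $M>0$ such that $$\frac{s_\Omega(z)}{c_\Omega(z)}\le M$$ for all $z\in\Omega$ and all $C^\infty$-smoothly bounded domains $\Omega\subset\mathbb C$. This is witnessed by the annuli $A_r=\{z\in\mathbb C: r<|z|<1\}$, $0<r<1$: they are $C^\infty$-smoothly bounded domains, and $$\frac{s_{A_r}(r^{1/2})}{c_{A_r}(r^{1/2})}\to+\infty\qquad\text{as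 } r\to0^+ .$$ -/

import Mathlib

open Set Filter Topology MeasureTheory
open scoped ContDiff

noncomputable section

namespace Planar

/-- A `C^∞`-smoothly bounded planar domain: a bounded, nonempty, connected open set which near each
boundary point is the sublevel set `{ψ < 0}` of a smooth function `ψ` with nonvanishing
differential. -/
structure IsSmoothlyBoundedDomain (Ω : Set ℂ) : Prop where
  isOpen : IsOpen Ω
  isConnected : IsConnected Ω
  isBounded : Bornology.IsBounded Ω
  smooth_boundary : ∀ p ∈ frontier Ω, ∃ (U : Set ℂ) (ψ : ℂ → ℝ), IsOpen U ∧ p ∈ U ∧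
    ContDiffOn ℝ ∞ ψ U ∧ (∀ z ∈ U, fderiv ℝ ψ z ≠ 0) ∧ Ω ∩ U = {z | z ∈ U ∧ ψ z < 0}

/-- The Carathéodory metric
`c_Ω(z) = sup {|f'(z)| : f : Ω → 𝔻 holomorphic, f(z) = 0}`. -/
def caratheodoryMetric (Ω : Set ℂ) (z : ℂ) : ℝ :=
  sSup {x : ℝ | ∃ f : ℂ → ℂ, DifferentiableOn ℂ f Ω ∧ MapsTo f Ω (Metric.ball 0 1) ∧
    f z = 0 ∧ x = ‖deriv f z‖}

/-- Arc length on the boundary: one-dimensional Hausdorff measure restricted to `∂Ω`. -/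
def arcLength (Ω : Set ℂ) : Measure ℂ :=
  (Measure.hausdorffMeasure 1 : Measure ℂ).restrict (frontier Ω)

/-- The functions that are holomorphic on `Ω` and smooth on the closure of `Ω`. -/
def smoothHolomorphic (Ω : Set ℂ) : Submodule ℂ (ℂ → ℂ) where
  carrier := {f | DifferentiableOn ℂ f Ω ∧ ContDiffOn ℝ ∞ f (closure Ω)}
  zero_mem' := ⟨differentiableOn_const 0, contDiffOn_const⟩
  add_mem' := fun hf hg => ⟨hf.1.add hg.1, hf.2.add hg.2⟩
  smul_mem' := fun c _ hf => ⟨hf.1.const_smul c, hf.2.const_smul c⟩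

/-- The boundary traces in `L²(∂Ω)` of functions holomorphic on `Ω` and smooth on its closure. -/
def boundaryTraces (Ω : Set ℂ) : Submodule ℂ (Lp ℂ 2 (arcLength Ω)) where
  carrier := {g | ∃ f ∈ smoothHolomorphic Ω, g =ᵐ[arcLength Ω] f}
  zero_mem' := ⟨0, (smoothHolomorphic Ω).zero_mem, Lp.coeFn_zero ℂ 2 (arcLength Ω)⟩
  add_mem' := by
    rintro g₁ g₂ ⟨f₁, hf₁, h₁⟩ ⟨f₂, hf₂, h₂⟩
    exact ⟨f₁ + f₂, (smoothHolomorphic Ω).add_mem hf₁ hf₂, (Lp.coeFn_add g₁ g₂).trans (h₁.add h₂)⟩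
  smul_mem' := by
    rintro c g ⟨f, hf, h⟩
    exact ⟨c • f, (smoothHolomorphic Ω).smul_mem c hf,
      (Lp.coeFn_smul c g).trans (h.const_smul c)⟩

/-- The Hardy space `H²(∂Ω)`: the closure of the boundary traces in `L²(∂Ω)`. -/
def hardySpace (Ω : Set ℂ) : Submodule ℂ (Lp ℂ 2 (arcLength Ω)) :=
  (boundaryTraces Ω).topologicalClosure

/-- `F` is the holomorphic extension to `Ω` of the element `h` of the Hardy space: there are
functions, holomorphic on `Ω` and smooth on its closure, whose boundary traces tend to `h` in
`L²(∂Ω)` and which tend to `F` locally uniformly on `Ω`.  (On a smoothly bounded domain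
convergence of the traces in `L²(∂Ω)` forces locally uniform convergence, to the Poisson integral
of `h`, so `F` exists and is unique on `Ω`.) -/
def IsHolomorphicExtension (Ω : Set ℂ) (h : Lp ℂ 2 (arcLength Ω)) (F : ℂ → ℂ) : Prop :=
  DifferentiableOn ℂ F Ω ∧
  ∃ f : ℕ → ℂ → ℂ, (∀ n, f n ∈ smoothHolomorphic Ω) ∧
    Tendsto (fun n => eLpNorm (fun ζ => f n ζ - h ζ) 2 (arcLength Ω)) atTop (𝓝 0) ∧
    TendstoLocallyUniformlyOn f F atTop Ω

/-- `S` is the Szegő kernel of `Ω`: it is Hermitian symmetric, and for each `w ∈ Ω` the function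
`S(·, w)` is (the holomorphic extension of) an element `k` of the Hardy space such that
`F(w) = ∫ conj(k) h ds` for each `h` in the Hardy space with holomorphic extension `F`. -/
structure IsSzegoKernel (Ω : Set ℂ) (S : ℂ → ℂ → ℂ) : Prop where
  symm : ∀ z ∈ Ω, ∀ w ∈ Ω, S z w = starRingEnd ℂ (S w z)
  reproducing : ∀ w ∈ Ω, ∃ k ∈ hardySpace Ω, IsHolomorphicExtension Ω k (fun z => S z w) ∧
    ∀ h ∈ hardySpace Ω, ∀ F : ℂ → ℂ, IsHolomorphicExtension Ω h F →
      F w = ∫ ζ, starRingEnd ℂ (k ζ) * h ζ ∂(arcLength Ω)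

open Classical in
/-- The Szegő kernel of `Ω` (uniquely determined on `Ω × Ω` by `IsSzegoKernel`). -/
def szegoKernel (Ω : Set ℂ) : ℂ → ℂ → ℂ :=
  if h : ∃ S, IsSzegoKernel Ω S then h.choose else 0

/-- The Wirtinger derivative `∂/∂z = (∂/∂x - i ∂/∂y) / 2`. -/
def dz (u : ℂ → ℂ) (z : ℂ) : ℂ :=
  (fderiv ℝ u z 1 - Complex.I * fderiv ℝ u z Complex.I) / 2

/-- The Wirtinger derivative `∂/∂z̄ = (∂/∂x + i ∂/∂y) / 2`. -/
def dzbar (u : ℂ → ℂ) (z : ℂ) : ℂ :=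
  (fderiv ℝ u z 1 + Complex.I * fderiv ℝ u z Complex.I) / 2

/-- The Szegő metric `s_Ω(z) = √(∂² log S_Ω(z, z) / ∂z ∂z̄)`. -/
def szegoMetric (Ω : Set ℂ) (z : ℂ) : ℝ :=
  √(dz (dzbar fun w => ((Real.log (szegoKernel Ω w w).re : ℝ) : ℂ)) z).re

/-- The annulus `A_r = {z : r < |z| < 1}`. -/
def annulus (r : ℝ) : Set ℂ := {z | r < ‖z‖ ∧ ‖z‖ < 1}

end Planar

end

noncomputable section

namespace Planar

/-! On `A_r` the monomials `z ^ n` are orthogonal in the Hardy space, with squared norm `L (1 + r ^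
(2n+1))`, where `L` is the length of the unit circle. Hence `S(z, w) = L⁻¹ ∑ (z w̄) ^ n / (1 + r ^
(2n+1))`, summed over all integers. The numerical value of `L` never matters, since the constant
`L⁻¹` disappears from `∂∂̄ log S`.

On the diagonal `S` depends only on `t = |z|²`, and `∂∂̄ log S = t⁻¹ (t d/dt)² log S`. This is `t⁻¹`
times the variance of `n` for the probability weights proportional to `t ^ n / (1 + r ^ (2n+1))`. At
`t = r`, that is at `z = √r`, the weights are invariant under `n ↦ -1 - n`, so the mean is `-1/2`.
As `n (n + 1) ≥ 0` for integers, the second moment is at least `1/2` and the variance at least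
`1/4`. So `s(√r) ≥ 1 / (2√r)` (`le_szegoMetric_annulus`).

The Carathéodory metric is smaller: `w ↦ √r e^w` maps the disc of radius `-log r / 2` into `A_r`,
and the Schwarz lemma gives `c(√r) ≤ 2 / (√r (-log r))` (`caratheodoryMetric_annulus_pos_and_le`).
The ratio is therefore at least `-log r / 4`, which is unbounded as `r → 0⁺`.

The remaining work identifies the kernel (`annulusSzegoKernel_reproducing`, `IsSzegoKernel.eq`):
termwise integration over both boundary circles recovers the Laurent expansion of a function smooth
up to the boundary, and continuity of the inner product extends this to the Hardy space. -/

/-! ### Topology and boundary of the annulus -/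

lemma isOpen_annulus (r : ℝ) : IsOpen (annulus r) :=
  (isOpen_lt continuous_const continuous_norm).inter (isOpen_lt continuous_norm continuous_const)

lemma closure_annulus {r : ℝ} (hr : 0 < r) (hr1 : r < 1) :
    closure (annulus r) = {z : ℂ | r ≤ ‖z‖ ∧ ‖z‖ ≤ 1} := by
  apply Subset.antisymm
  · refine closure_minimal (fun z hz => ⟨hz.1.le, hz.2.le⟩) ?_
    exact (isClosed_le continuous_const continuous_norm).inter
      (isClosed_le continuous_norm continuous_const)
  · rintro z ⟨h1, h2⟩
    have hz : ‖z‖ ≠ 0 := (hr.trans_le h1).ne'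
    have hz' : (‖z‖ : ℂ) ≠ 0 := by exact_mod_cast hz
    have hmaps : MapsTo (fun x : ℝ => z / ‖z‖ * (x : ℂ)) (Ioo r 1) (annulus r) := by
      intro x hx
      have : ‖z / ‖z‖ * (x : ℂ)‖ = x := by
        rw [norm_mul, norm_div, Complex.norm_real, Complex.norm_real, norm_norm, div_self hz,
          one_mul, Real.norm_of_nonneg (hr.trans hx.1).le]
      exact ⟨this.symm ▸ hx.1, this.symm ▸ hx.2⟩
    have hcont : Continuous (fun x : ℝ => z / ‖z‖ * (x : ℂ)) := by fun_prop
    have hmem : ‖z‖ ∈ closure (Ioo r 1) := by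
      rw [closure_Ioo hr1.ne]; exact ⟨h1, h2⟩
    have := map_mem_closure hcont hmem hmaps
    rwa [div_mul_cancel₀ _ hz'] at this

lemma frontier_annulus {r : ℝ} (hr : 0 < r) (hr1 : r < 1) :
    frontier (annulus r) = Metric.sphere (0 : ℂ) 1 ∪ Metric.sphere 0 r := by
  rw [(isOpen_annulus r).frontier_eq, closure_annulus hr hr1]
  ext z
  simp only [Set.mem_sdiff, mem_ofPred_eq, annulus, mem_union, mem_sphere_iff_norm, sub_zero, not_and,
    not_lt]
  constructor
  · rintro ⟨⟨h1, h2⟩, h3⟩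
    rcases h1.lt_or_eq with h | h
    · exact Or.inl (h2.antisymm (h3 h))
    · exact Or.inr h.symm
  · rintro (h | h) <;> rw [h]
    · exact ⟨⟨hr1.le, le_rfl⟩, fun _ => le_rfl⟩
    · exact ⟨⟨le_rfl, hr1.le⟩, fun h => (lt_irrefl _ h).elim⟩

lemma sqrt_mem_annulus {r : ℝ} (hr : 0 < r) (hr1 : r < 1) : ((√r : ℝ) : ℂ) ∈ annulus r := by
  have hs : 0 < √r := Real.sqrt_pos.2 hr
  have hs1 : √r < 1 := by rw [Real.sqrt_lt' one_pos]; simpa using hr1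
  have : ‖((√r : ℝ) : ℂ)‖ = √r := by rw [Complex.norm_real, Real.norm_of_nonneg hs.le]
  refine ⟨?_, ?_⟩ <;> rw [this]
  · nlinarith [Real.mul_self_sqrt hr.le]
  · exact hs1

lemma annulus_eq_exp_image {r : ℝ} (hr : 0 < r) :
    annulus r = Complex.exp '' (Complex.re ⁻¹' Ioo (Real.log r) 0) := by
  ext z
  constructor
  · rintro ⟨h1, h2⟩
    have hz : 0 < ‖z‖ := hr.trans h1
    refine ⟨Complex.log z, ⟨?_, ?_⟩, Complex.exp_log (norm_pos_iff.1 hz)⟩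
    · rw [Complex.log_re]; exact Real.log_lt_log hr h1
    · rw [Complex.log_re]; exact Real.log_neg hz h2
  · rintro ⟨w, ⟨h1, h2⟩, rfl⟩
    refine ⟨?_, ?_⟩
    · rw [Complex.norm_exp]; exact (Real.log_lt_iff_lt_exp hr).1 h1
    · rw [Complex.norm_exp]; exact Real.exp_lt_one_iff.2 h2

lemma isConnected_annulus {r : ℝ} (hr : 0 < r) (hr1 : r < 1) : IsConnected (annulus r) := by
  refine ⟨⟨_, sqrt_mem_annulus hr hr1⟩, ?_⟩
  rw [annulus_eq_exp_image hr]
  refine IsPreconnected.image ?_ _ Complex.continuous_exp.continuousOn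
  exact ((convex_Ioo _ _).linear_preimage Complex.reLm).isPreconnected

lemma hasFDerivAt_norm_sq (z : ℂ) :
    HasFDerivAt (fun w : ℂ => ‖w‖ ^ 2) (2 • innerSL ℝ z) z :=
  (hasStrictFDerivAt_norm_sq z).hasFDerivAt

lemma fderiv_norm_sq_ne_zero {z : ℂ} (hz : z ≠ 0) :
    (2 • innerSL ℝ z : ℂ →L[ℝ] ℝ) ≠ 0 := by
  intro h
  have := DFunLike.congr_fun h z
  simp at this
  exact hz this

/-- The annuli are smoothly bounded domains. -/
lemma isSmoothlyBoundedDomain_annulus {r : ℝ} (hr : 0 < r) (hr1 : r < 1) :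
    IsSmoothlyBoundedDomain (annulus r) where
  isOpen := isOpen_annulus r
  isConnected := isConnected_annulus hr hr1
  isBounded := Metric.isBounded_ball.subset
    (fun z hz => by simpa using hz.2 : annulus r ⊆ Metric.ball (0 : ℂ) 1)
  smooth_boundary := by
    intro p hp
    rw [frontier_annulus hr hr1] at hp
    rcases hp with hp | hp
    · have hp : ‖p‖ = 1 := by simpa using hp
      -- The neighbourhood stays away from the other boundary circle and from the origin, where the
      -- differential of `‖z‖ ^ 2` vanishes.
      refine ⟨{z | r < ‖z‖}, fun z => ‖z‖ ^ 2 - 1, isOpen_lt continuous_const continuous_norm,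
        by rwa [mem_ofPred_eq, hp], ((contDiff_norm_sq ℝ).sub contDiff_const).contDiffOn, ?_, ?_⟩
      · intro z hz
        rw [((hasFDerivAt_norm_sq z).sub_const 1).fderiv]
        exact fderiv_norm_sq_ne_zero (norm_pos_iff.1 (hr.trans hz))
      · ext z
        have : ‖z‖ ^ 2 - 1 < 0 ↔ ‖z‖ < 1 := by
          rw [sub_neg, sq_lt_one_iff₀ (norm_nonneg z)]
        simp only [annulus, mem_inter_iff, mem_ofPred_eq, this]
        tauto
    · have hp : ‖p‖ = r := by simpa using hp
      refine ⟨{z | 0 < ‖z‖ ∧ ‖z‖ < 1}, fun z => r ^ 2 - ‖z‖ ^ 2, isOpen_annulus 0,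
        by rw [mem_ofPred_eq, hp]; exact ⟨hr, hr1⟩,
        (contDiff_const.sub (contDiff_norm_sq ℝ)).contDiffOn, ?_, ?_⟩
      · intro z hz
        rw [((hasFDerivAt_norm_sq z).const_sub (r ^ 2)).fderiv]
        exact neg_ne_zero.2 (fderiv_norm_sq_ne_zero (norm_pos_iff.1 hz.1))
      · ext z
        have : r ^ 2 - ‖z‖ ^ 2 < 0 ↔ r < ‖z‖ := by
          rw [sub_neg, sq_lt_sq₀ hr.le (norm_nonneg z)]
        simp only [annulus, mem_inter_iff, mem_ofPred_eq, this]
        constructor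
        · tauto
        · rintro ⟨⟨_, h1⟩, h2⟩
          exact ⟨⟨h2, h1⟩, hr.trans h2, h1⟩

/-! ### The Carathéodory metric at `√r` -/

/-- Schwarz lemma for `f (√r e^w)` on a disc inscribed in the strip that covers the annulus.
Positivity is needed to divide by the metric, since a quotient by zero would be zero. -/
lemma caratheodoryMetric_annulus_pos_and_le {r : ℝ} (hr : 0 < r) (hr1 : r < 1) :
    0 < caratheodoryMetric (annulus r) ((√r : ℝ) : ℂ) ∧
    caratheodoryMetric (annulus r) ((√r : ℝ) : ℂ) ≤ 2 / (√r * -Real.log r) := by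
  have hs : 0 < √r := Real.sqrt_pos.2 hr
  have hL : 0 < -Real.log r := neg_pos.2 (Real.log_neg hr hr1)
  have hmem := sqrt_mem_annulus hr hr1
  set p : ℂ := ((√r : ℝ) : ℂ) with hp
  have hp0 : p ≠ 0 := by rw [hp]; exact_mod_cast hs.ne'
  have hpn : ‖p‖ = √r := by rw [hp, Complex.norm_real, Real.norm_of_nonneg hs.le]
  have hbound : ∀ x ∈ {x : ℝ | ∃ f : ℂ → ℂ, DifferentiableOn ℂ f (annulus r) ∧
      MapsTo f (annulus r) (Metric.ball 0 1) ∧ f p = 0 ∧ x = ‖deriv f p‖},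
      x ≤ 2 / (√r * -Real.log r) := by
    rintro x ⟨f, hf, hmaps, hfp, rfl⟩
    have hmapsexp : MapsTo (fun w => p * Complex.exp w) (Metric.ball 0 (-Real.log r / 2))
        (annulus r) := by
      intro w hw
      have hw : |w.re| < -Real.log r / 2 :=
        (Complex.abs_re_le_norm w).trans_lt (by simpa using hw)
      have hn : ‖p * Complex.exp w‖ = Real.exp (Real.log r / 2 + w.re) := by
        rw [norm_mul, hpn, Complex.norm_exp, Real.exp_add, Real.sqrt_eq_rpow,
          Real.rpow_def_of_pos hr]
        ring_nf
      rw [abs_lt] at hw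
      refine ⟨?_, ?_⟩ <;> rw [hn]
      · rw [← Real.log_lt_iff_lt_exp hr]; linarith
      · rw [Real.exp_lt_one_iff]; linarith
    have hd : DifferentiableOn ℂ (fun w => f (p * Complex.exp w))
        (Metric.ball 0 (-Real.log r / 2)) :=
      hf.comp (by fun_prop) hmapsexp
    have h1 := Complex.norm_deriv_le_div_of_mapsTo_ball (R₂ := 1) hd (by
      intro w hw
      have := hmaps (hmapsexp hw)
      simp only [Complex.exp_zero, mul_one, hfp]
      exact Metric.ball_subset_closedBall this) (half_pos hL)
    have hfd : HasDerivAt f (deriv f p) p :=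
      (hf.differentiableAt ((isOpen_annulus r).mem_nhds hmem)).hasDerivAt
    have h2 : HasDerivAt (fun w => f (p * Complex.exp w)) (deriv f p * p) 0 := by
      have he : HasDerivAt (fun w => p * Complex.exp w) p 0 := by
        simpa using (Complex.hasDerivAt_exp 0).const_mul p
      have hfd' : HasDerivAt f (deriv f p) (p * Complex.exp 0) := by simpa using hfd
      exact hfd'.comp 0 he
    rw [h2.deriv, norm_mul, hpn] at h1
    rw [le_div_iff₀ (by positivity)]
    rw [le_div_iff₀ (by positivity)] at h1
    linarith
  constructor
  -- Two points of the annulus are less than 2 apart, so `(z - p) / 2` is an admissible competitor.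
  · have h2 : ‖deriv (fun z : ℂ => (z - p) / 2) p‖ = 1 / 2 := by
      have : HasDerivAt (fun z : ℂ => (z - p) / 2) (1 / 2) p :=
        ((hasDerivAt_id p).sub_const p).div_const 2
      rw [this.deriv]; simp
    refine (by norm_num : (0 : ℝ) < 1 / 2).trans_le ?_
    refine le_csSup ⟨_, hbound⟩ ⟨fun z => (z - p) / 2, by fun_prop, ?_, by simp, h2.symm⟩
    intro z hz
    have : ‖z - p‖ < 2 := (norm_sub_le z p).trans_lt (by linarith [hz.2, hmem.2])
    simp only [mem_ball_zero_iff, norm_div, Complex.norm_ofNat]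
    linarith
  · refine Real.sSup_le hbound ?_
    positivity

/-! ### Arc length on circles and circle averages -/

open Measure in
lemma hausdorffMeasure_sphere_lt_top (ρ : ℝ) :
    μH[1] (Metric.sphere (0 : ℂ) ρ) < ⊤ := by
  rcases lt_or_ge ρ 0 with h | h
  · simp [Metric.sphere_eq_empty_of_neg h]
  have himg : circleMap 0 ρ '' Ioc 0 (2 * Real.pi) = Metric.sphere 0 ρ := by
    rw [image_circleMap_Ioc, abs_of_nonneg h]
  rw [← himg]
  refine ((lipschitzWith_circleMap 0 ρ).lipschitzOnWith.hausdorffMeasure_image_le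
    zero_le_one).trans_lt ?_
  rw [hausdorffMeasure_real, Real.volume_Ioc]
  exact ENNReal.mul_lt_top (by simp) ENNReal.ofReal_lt_top

-- Projection to the real axis is 1-Lipschitz and maps the circle onto a set containing `[-1, 1]`.
open Measure in
lemma hausdorffMeasure_unit_sphere_pos : 0 < μH[1] (Metric.sphere (0 : ℂ) 1) := by
  have hsub : Icc (-1 : ℝ) 1 ⊆ Complex.re '' Metric.sphere (0 : ℂ) 1 := by
    intro x hx
    refine ⟨Complex.exp (Real.arccos x * Complex.I), ?_, ?_⟩
    · simp [Complex.norm_exp_ofReal_mul_I]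
    · rw [Complex.exp_ofReal_mul_I_re, Real.cos_arccos hx.1 hx.2]
  have hlip : LipschitzWith 1 Complex.re := by
    refine LipschitzWith.of_dist_le_mul fun z w => ?_
    rw [Real.dist_eq, ← Complex.sub_re, NNReal.coe_one, one_mul, dist_eq_norm]
    exact Complex.abs_re_le_norm _
  have h1 : μH[1] (Complex.re '' Metric.sphere (0 : ℂ) 1) ≤ μH[1] (Metric.sphere (0 : ℂ) 1) := by
    simpa using (hlip.lipschitzOnWith (s := Metric.sphere (0 : ℂ) 1)).hausdorffMeasure_image_le
      (zero_le_one : (0 : ℝ) ≤ 1)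
  refine lt_of_lt_of_le ?_ ((measure_mono hsub).trans h1)
  rw [hausdorffMeasure_real, Real.volume_Icc]
  norm_num

open Measure Pointwise in
lemma hausdorffMeasure_sphere {ρ : ℝ} (hρ : 0 < ρ) :
    (μH[1] : Measure ℂ).real (Metric.sphere (0 : ℂ) ρ) =
      ρ * (μH[1] : Measure ℂ).real (Metric.sphere (0 : ℂ) 1) := by
  have h : Metric.sphere (0 : ℂ) ρ = ρ • Metric.sphere (0 : ℂ) 1 := by
    rw [smul_sphere' hρ.ne']; simp [abs_of_pos hρ]
  rw [measureReal_def, h, hausdorffMeasure_smul₀ zero_le_one hρ.ne', measureReal_def,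
    ENNReal.smul_def, smul_eq_mul, ENNReal.toReal_mul]
  simp [abs_of_pos hρ]

open Measure in
lemma setIntegral_sphere_mul (ρ θ : ℝ) (φ : ℂ → ℂ) :
    ∫ ζ in Metric.sphere (0 : ℂ) ρ, φ (Complex.exp (θ * Complex.I) * ζ) ∂μH[1] =
      ∫ ζ in Metric.sphere (0 : ℂ) ρ, φ ζ ∂μH[1] := by
  let e : ℂ ≃ᵢ ℂ := (rotation (Circle.exp θ)).toIsometryEquiv
  have he : ∀ ζ, e ζ = Complex.exp (θ * Complex.I) * ζ := fun ζ => by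
    simp [e, rotation_apply]
  have hpre : e ⁻¹' Metric.sphere (0 : ℂ) ρ = Metric.sphere (0 : ℂ) ρ := by
    ext ζ
    rw [mem_preimage, mem_sphere_zero_iff_norm, mem_sphere_zero_iff_norm, he, norm_mul,
      Complex.norm_exp_ofReal_mul_I, one_mul]
  have := (e.measurePreserving_hausdorffMeasure 1).setIntegral_preimage_emb
    e.toHomeomorph.measurableEmbedding φ (Metric.sphere (0 : ℂ) ρ)
  rw [hpre] at this
  simpa only [he] using this

open Measure in
/-- The integral over a circle with respect to Hausdorff measure is the circle average, up to the
total mass. -/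
lemma setIntegral_sphere_eq_circleAverage (ρ : ℝ) {φ : ℂ → ℂ}
    (hφ : ContinuousOn φ (Metric.sphere 0 ρ)) :
    ∫ ζ in Metric.sphere (0 : ℂ) ρ, φ ζ ∂μH[1] =
      (μH[1] : Measure ℂ).real (Metric.sphere (0 : ℂ) ρ) • Real.circleAverage φ 0 ρ := by
  set S := Metric.sphere (0 : ℂ) ρ with hS
  set ν : Measure ℂ := (μH[1]).restrict S with hν
  have : IsFiniteMeasure ν := ⟨by
    rw [hν, restrict_apply_univ]; exact hausdorffMeasure_sphere_lt_top ρ⟩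
  have hmaps : MapsTo (fun p : ℝ × ℂ => Complex.exp (p.1 * Complex.I) * p.2)
      (Icc 0 (2 * Real.pi) ×ˢ S) S := by
    rintro ⟨θ, ζ⟩ ⟨-, hζ⟩
    simpa [hS, Complex.norm_exp_ofReal_mul_I] using hζ
  have hcont : ContinuousOn (fun p : ℝ × ℂ => φ (Complex.exp (p.1 * Complex.I) * p.2))
      (Icc 0 (2 * Real.pi) ×ˢ S) :=
    hφ.comp (by fun_prop) hmaps
  have hint : Integrable (Function.uncurry fun (θ : ℝ) (ζ : ℂ) =>
      φ (Complex.exp (θ * Complex.I) * ζ)) ((volume.restrict (uIoc 0 (2 * Real.pi))).prod ν) := by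
    have h1 := hcont.integrableOn_compact (μ := volume.prod ν)
      (isCompact_Icc.prod (isCompact_sphere 0 ρ))
    rw [IntegrableOn, ← prod_restrict, hν, restrict_restrict_of_subset subset_rfl] at h1
    refine h1.mono_measure (Measure.prod_mono (Measure.restrict_mono ?_ le_rfl) le_rfl)
    rw [uIoc_of_le Real.two_pi_pos.le]
    exact Ioc_subset_Icc_self
  -- Average over rotations and apply Fubini: rotation invariance makes the integral over the circle
  -- constant in `θ`, while for fixed `ζ` the integral over `θ` is a circle average started at the
  -- argument of `ζ`.
  have hswap := intervalIntegral_integral_swap hint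
  have hleft : ∫ θ in (0 : ℝ)..(2 * Real.pi), ∫ ζ, φ (Complex.exp (θ * Complex.I) * ζ) ∂ν =
      (2 * Real.pi) • ∫ ζ, φ ζ ∂ν := by
    have h (θ : ℝ) : ∫ ζ, φ (Complex.exp (θ * Complex.I) * ζ) ∂ν = ∫ ζ, φ ζ ∂ν :=
      setIntegral_sphere_mul ρ θ φ
    simp_rw [h]
    simp
  have hright : ∫ ζ, (∫ θ in (0 : ℝ)..(2 * Real.pi), φ (Complex.exp (θ * Complex.I) * ζ)) ∂ν =
      ν.real univ • ((2 * Real.pi) • Real.circleAverage φ 0 ρ) := by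
    rw [← integral_const]
    refine setIntegral_congr_fun Metric.isClosed_sphere.measurableSet ?_
    intro ζ hζ
    have hζ' : ζ = circleMap 0 ρ ζ.arg := by
      have : ‖ζ‖ = ρ := by simpa [hS] using hζ
      rw [circleMap_zero, ← this, Complex.norm_mul_exp_arg_mul_I]
    have h2 := Real.circleAverage_eq_integral_add (f := φ) (c := 0) (R := ρ) ζ.arg
    dsimp only
    rw [h2, smul_smul, mul_inv_cancel₀ Real.two_pi_pos.ne', one_smul]
    refine intervalIntegral.integral_congr fun θ _ => ?_
    congr 1
    conv_lhs => rw [hζ']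
    simp only [circleMap_zero, Complex.ofReal_add, add_mul, Complex.exp_add]
    ring
  rw [hleft, hright, smul_comm] at hswap
  have h3 := smul_right_injective ℂ Real.two_pi_pos.ne' hswap
  rw [h3, hν, measureReal_restrict_apply_univ]

/-- The length of the unit circle. -/
def unitLength : ℝ := (Measure.hausdorffMeasure 1 : Measure ℂ).real (Metric.sphere (0 : ℂ) 1)

lemma unitLength_pos : 0 < unitLength :=
  ENNReal.toReal_pos hausdorffMeasure_unit_sphere_pos.ne' (hausdorffMeasure_sphere_lt_top 1).ne

lemma isFiniteMeasure_arcLength {r : ℝ} (hr : 0 < r) (hr1 : r < 1) :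
    IsFiniteMeasure (arcLength (annulus r)) := ⟨by
  rw [arcLength, Measure.restrict_apply_univ, frontier_annulus hr hr1]
  exact (measure_union_le _ _).trans_lt (ENNReal.add_lt_top.2
    ⟨hausdorffMeasure_sphere_lt_top 1, hausdorffMeasure_sphere_lt_top r⟩)⟩

lemma integral_arcLength {r : ℝ} (hr : 0 < r) (hr1 : r < 1) {φ : ℂ → ℂ}
    (hφ : ContinuousOn φ (frontier (annulus r))) :
    ∫ ζ, φ ζ ∂(arcLength (annulus r)) =
      unitLength * (Real.circleAverage φ 0 1 + r * Real.circleAverage φ 0 r) := by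
  have := isFiniteMeasure_arcLength hr hr1
  have hint : IntegrableOn φ (frontier (annulus r)) (Measure.hausdorffMeasure 1) := by
    have hc : IsCompact (frontier (annulus r)) := by
      rw [frontier_annulus hr hr1]
      exact (isCompact_sphere 0 1).union (isCompact_sphere 0 r)
    have h := hφ.integrableOn_compact (μ := arcLength (annulus r)) hc
    rwa [IntegrableOn, arcLength, Measure.restrict_restrict_of_subset subset_rfl] at h
  rw [frontier_annulus hr hr1] at hφ hint
  rw [arcLength, frontier_annulus hr hr1, setIntegral_union ?_
    Metric.isClosed_sphere.measurableSet hint.left_of_union hint.right_of_union,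
    setIntegral_sphere_eq_circleAverage 1 (hφ.mono subset_union_left),
    setIntegral_sphere_eq_circleAverage r (hφ.mono subset_union_right),
    hausdorffMeasure_sphere hr]
  · simp only [unitLength, Complex.real_smul, Complex.ofReal_mul]
    ring
  · rw [disjoint_left]
    intro z h1 h2
    have h1 : ‖z‖ = 1 := by simpa using h1
    have h2 : ‖z‖ = r := by simpa using h2
    linarith

/-! ### The Laurent series of the kernel and its derivatives -/

/-- The coefficients of the Szegő kernel of the annulus `A_r`. -/
def szegoCoeff (r : ℝ) (n : ℤ) : ℝ := (1 + r ^ (2 * n + 1))⁻¹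

/-- The Laurent series `∑ n ^ k t ^ n / (1 + r ^ (2 n + 1))`. -/
def szegoSeries (r : ℝ) (k : ℕ) (t : ℂ) : ℂ := ∑' n : ℤ, (n : ℂ) ^ k * szegoCoeff r n * t ^ n

lemma szegoCoeff_pos {r : ℝ} (hr : 0 < r) (n : ℤ) : 0 < szegoCoeff r n :=
  inv_pos.2 (by positivity)

lemma szegoCoeff_le_one {r : ℝ} (hr : 0 < r) (n : ℤ) : szegoCoeff r n ≤ 1 :=
  inv_le_one_of_one_le₀ (by have := zpow_pos hr (2 * n + 1); linarith)

lemma szegoCoeff_le {r : ℝ} (hr : 0 < r) (n : ℤ) : szegoCoeff r n ≤ (r ^ (2 * n + 1))⁻¹ :=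
  inv_anti₀ (zpow_pos hr _) (by linarith)

/-- A majorant of the terms of `szegoSeries` on `r ^ 2 / ρ ≤ ‖t‖ ≤ ρ`. -/
def szegoMajorant (r ρ : ℝ) (k : ℕ) (n : ℤ) : ℝ := (n.natAbs : ℝ) ^ k * (r⁻¹ * ρ ^ n.natAbs)

lemma summable_szegoMajorant (r : ℝ) {ρ : ℝ} (hρ : 0 < ρ) (hρ1 : ρ < 1) (k : ℕ) :
    Summable (szegoMajorant r ρ k) := by
  have h : Summable fun m : ℕ => (m : ℝ) ^ k * (r⁻¹ * ρ ^ m) := by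
    have := (summable_pow_mul_geometric_of_norm_lt_one k
      (by rwa [Real.norm_of_nonneg hρ.le] : ‖ρ‖ < 1)).mul_left r⁻¹
    exact this.congr fun m => by ring
  refine Summable.of_nat_of_neg ?_ ?_ <;> simpa [szegoMajorant] using h

/-- The coefficient is at most `1`, which serves for `n ≥ 0`, and at most `r ^ (-(2n+1))`, which
serves for `n < 0`. This is why the series converges on `r ^ 2 < ‖t‖ < 1`. -/
lemma norm_szego_term_le {r ρ : ℝ} (hr : 0 < r) (hr1 : r < 1) (hρ : 0 < ρ) {t : ℂ}
    (h1 : r ^ 2 / ρ ≤ ‖t‖) (h2 : ‖t‖ ≤ ρ) (k : ℕ) (n : ℤ) :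
    ‖(n : ℂ) ^ k * szegoCoeff r n * t ^ n‖ ≤ szegoMajorant r ρ k n := by
  have ht : 0 < ‖t‖ := lt_of_lt_of_le (by positivity) h1
  have hkey : szegoCoeff r n * ‖t‖ ^ n ≤ r⁻¹ * ρ ^ n.natAbs := by
    obtain ⟨m, rfl | rfl⟩ := n.eq_nat_or_neg
    · rw [zpow_natCast, Int.natAbs_natCast]
      gcongr
      exact (szegoCoeff_le_one hr _).trans ((one_le_inv₀ hr).2 hr1.le)
    · rw [Int.natAbs_neg, Int.natAbs_natCast]
      have h3 : (r ^ (2 * -(m : ℤ) + 1))⁻¹ = r⁻¹ * (r ^ 2) ^ m := by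
        rw [zpow_add₀ hr.ne', zpow_one, mul_inv, mul_comm, zpow_mul, zpow_neg, inv_inv,
          zpow_natCast]
        norm_cast
      have h4 : ‖t‖ ^ (-(m : ℤ)) ≤ (ρ / r ^ 2) ^ m := by
        rw [zpow_neg, zpow_natCast, ← inv_pow]
        gcongr
        rw [← inv_div]
        exact inv_anti₀ (by positivity) h1
      calc szegoCoeff r (-(m : ℤ)) * ‖t‖ ^ (-(m : ℤ))
          ≤ (r⁻¹ * (r ^ 2) ^ m) * (ρ / r ^ 2) ^ m := by
            gcongr
            exact (szegoCoeff_le hr _).trans_eq h3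
        _ = r⁻¹ * ρ ^ m := by
            rw [mul_assoc, ← mul_pow, mul_div_cancel₀ _ (by positivity : r ^ 2 ≠ 0)]
  rw [mul_assoc, norm_mul, norm_pow, norm_mul, norm_zpow, Complex.norm_real,
    Real.norm_of_nonneg (szegoCoeff_pos hr n).le, szegoMajorant, Complex.norm_intCast,
    Nat.cast_natAbs, Int.cast_abs]
  gcongr

lemma exists_radius {r : ℝ} {t : ℂ} (h0 : r ≠ 0) (h1 : r ^ 2 < ‖t‖) (h2 : ‖t‖ < 1) :
    ∃ ρ, 0 < ρ ∧ ρ < 1 ∧ r ^ 2 / ρ < ‖t‖ ∧ ‖t‖ < ρ := by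
  have ht : 0 < ‖t‖ := lt_of_le_of_lt (by positivity) h1
  obtain ⟨ρ, h3, h4⟩ := exists_between (max_lt h2 ((div_lt_one ht).2 h1))
  have h5 := max_lt_iff.1 h3
  have hρ : 0 < ρ := ht.trans h5.1
  refine ⟨ρ, hρ, h4, ?_, h5.1⟩
  rw [div_lt_comm₀ hρ ht]
  exact h5.2

lemma hasSum_szegoSeries {r : ℝ} (hr : 0 < r) (hr1 : r < 1) {t : ℂ} (h1 : r ^ 2 < ‖t‖)
    (h2 : ‖t‖ < 1) (k : ℕ) :
    HasSum (fun n : ℤ => (n : ℂ) ^ k * szegoCoeff r n * t ^ n) (szegoSeries r k t) := by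
  obtain ⟨ρ, h3, h4, h5, h6⟩ := exists_radius hr.ne' h1 h2
  exact (Summable.of_norm_bounded (summable_szegoMajorant r h3 h4 k)
    (norm_szego_term_le hr hr1 h3 h5.le h6.le k)).hasSum

/-- The operator `t d/dt` multiplies the `n`-th term by `n`, so it raises `k` by one. -/
lemma hasDerivAt_szegoSeries {r : ℝ} (hr : 0 < r) (hr1 : r < 1) {t : ℂ} (h1 : r ^ 2 < ‖t‖)
    (h2 : ‖t‖ < 1) (k : ℕ) :
    HasDerivAt (szegoSeries r k) (szegoSeries r (k + 1) t / t) t := by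
  obtain ⟨ρ, h3, h4, h5, h6⟩ := exists_radius hr.ne' h1 h2
  set U : Set ℂ := {t | r ^ 2 / ρ < ‖t‖ ∧ ‖t‖ < ρ} with hU
  have hUo : IsOpen U :=
    (isOpen_lt continuous_const continuous_norm).inter (isOpen_lt continuous_norm continuous_const)
  have hne : ∀ s ∈ U, s ≠ 0 := fun s hs =>
    norm_pos_iff.1 (lt_trans (by positivity) hs.1)
  have htU : t ∈ U := ⟨h5, h6⟩
  have hd : ∀ n : ℤ, ∀ s ∈ U, HasDerivAt (fun s : ℂ => (n : ℂ) ^ k * szegoCoeff r n * s ^ n)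
      ((n : ℂ) ^ (k + 1) * szegoCoeff r n * s ^ n / s) s := by
    intro n s hs
    refine ((hasDerivAt_zpow n s (Or.inl (hne s hs))).const_mul _).congr_deriv ?_
    rw [zpow_sub_one₀ (hne s hs)]
    ring
  have hdiff : ∀ n : ℤ, DifferentiableOn ℂ
      (fun s : ℂ => (n : ℂ) ^ k * szegoCoeff r n * s ^ n) U :=
    fun n s hs => (hd n s hs).differentiableAt.differentiableWithinAt
  have hle : ∀ n : ℤ, ∀ s ∈ U, ‖(n : ℂ) ^ k * szegoCoeff r n * s ^ n‖ ≤ szegoMajorant r ρ k n :=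
    fun n s hs => norm_szego_term_le hr hr1 h3 hs.1.le hs.2.le k n
  have hsum := summable_szegoMajorant r h3 h4 k
  have hA := (Complex.differentiableOn_tsum_of_summable_norm hsum hdiff hUo hle).differentiableAt
    (hUo.mem_nhds htU)
  have hB := Complex.hasSum_deriv_of_summable_norm hsum hdiff hUo hle htU
  have hC := (hasSum_szegoSeries hr hr1 h1 h2 (k + 1)).div_const t
  simp_rw [fun n => (hd n t htU).deriv] at hB
  exact hA.hasDerivAt.congr_deriv (hB.unique hC)

lemma szegoSeries_conj (r : ℝ) (k : ℕ) (t : ℂ) :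
    szegoSeries r k (starRingEnd ℂ t) = starRingEnd ℂ (szegoSeries r k t) := by
  rw [szegoSeries, szegoSeries, Complex.conj_tsum]
  simp

/-- The values of `szegoSeries` at real points. -/
def realSzegoSeries (r : ℝ) (k : ℕ) (t : ℝ) : ℝ := ∑' n : ℤ, (n : ℝ) ^ k * szegoCoeff r n * t ^ n

lemma ofReal_realSzegoSeries (r : ℝ) (k : ℕ) (t : ℝ) :
    szegoSeries r k (t : ℂ) = (realSzegoSeries r k t : ℂ) := by
  rw [szegoSeries, realSzegoSeries]
  push_cast
  rfl

lemma hasSum_realSzegoSeries {r : ℝ} (hr : 0 < r) (hr1 : r < 1) {t : ℝ} (h1 : r ^ 2 < t)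
    (h2 : t < 1) (k : ℕ) :
    HasSum (fun n : ℤ => (n : ℝ) ^ k * szegoCoeff r n * t ^ n) (realSzegoSeries r k t) := by
  have ht : ‖(t : ℂ)‖ = t := by
    rw [Complex.norm_real, Real.norm_of_nonneg ((sq_nonneg r).trans h1.le)]
  have := hasSum_szegoSeries hr hr1 (by rwa [ht]) (by rwa [ht]) k
  rw [ofReal_realSzegoSeries] at this
  exact_mod_cast this

lemma hasDerivAt_realSzegoSeries {r : ℝ} (hr : 0 < r) (hr1 : r < 1) {t : ℝ} (h1 : r ^ 2 < t)
    (h2 : t < 1) (k : ℕ) :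
    HasDerivAt (realSzegoSeries r k) (realSzegoSeries r (k + 1) t / t) t := by
  have ht : ‖(t : ℂ)‖ = t := by
    rw [Complex.norm_real, Real.norm_of_nonneg ((sq_nonneg r).trans h1.le)]
  have := (hasDerivAt_szegoSeries hr hr1 (by rwa [ht]) (by rwa [ht]) k).real_of_complex
  simp only [ofReal_realSzegoSeries, Complex.ofReal_re, ← Complex.ofReal_div] at this
  exact this

lemma realSzegoSeries_zero_pos {r : ℝ} (hr : 0 < r) (hr1 : r < 1) {t : ℝ} (h1 : r ^ 2 < t)
    (h2 : t < 1) : 0 < realSzegoSeries r 0 t := by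
  have ht : 0 < t := lt_of_le_of_lt (sq_nonneg r) h1
  have hpos : ∀ n : ℤ, 0 < (n : ℝ) ^ 0 * szegoCoeff r n * t ^ n := fun n => by
    have := szegoCoeff_pos hr n
    positivity
  exact (hasSum_realSzegoSeries hr hr1 h1 h2 0).summable.tsum_pos (fun n => (hpos n).le) 0 (hpos 0)

/-! ### Moments of the weights at the symmetric point `t = r` -/

/-- The weights are symmetric under `n ↦ -1 - n`, so their mean is `-1/2`. -/
lemma realSzegoSeries_one_self {r : ℝ} (hr : 0 < r) (hr1 : r < 1) :
    realSzegoSeries r 1 r = -realSzegoSeries r 0 r / 2 := by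
  have h1 : r ^ 2 < r := by nlinarith
  have hA := hasSum_realSzegoSeries hr hr1 h1 hr1 1
  have h0 := hasSum_realSzegoSeries hr hr1 h1 hr1 0
  have hrefl : ∀ n : ℤ, szegoCoeff r (-1 - n) * r ^ (-1 - n) = szegoCoeff r n * r ^ n := by
    intro n
    have hp := zpow_pos hr n
    rw [szegoCoeff, szegoCoeff, show 2 * (-1 - n) + 1 = -(n + n) - 1 by ring,
      show -1 - n = -n - 1 by ring, show 2 * n + 1 = n + n + 1 by ring, zpow_sub_one₀ hr.ne',
      zpow_sub_one₀ hr.ne', zpow_add_one₀ hr.ne', zpow_neg, zpow_neg, zpow_add₀ hr.ne']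
    field_simp
    ring
  have hB := (Equiv.subLeft (-1 : ℤ)).hasSum_iff.2 hA
  have hC := hA.add hB
  have hD : HasSum (fun n : ℤ => -((n : ℝ) ^ 0 * szegoCoeff r n * r ^ n))
      (realSzegoSeries r 1 r + realSzegoSeries r 1 r) := by
    refine hC.congr_fun ?_
    intro n
    simp only [Function.comp, Equiv.subLeft_apply, pow_one, mul_assoc, hrefl]
    push_cast
    ring
  linarith [hD.unique h0.neg]

/-- Since `n + n ^ 2 ≥ 0` for every integer, the second moment is at least minus the first. -/
lemma realSzegoSeries_two_self {r : ℝ} (hr : 0 < r) (hr1 : r < 1) :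
    realSzegoSeries r 0 r / 2 ≤ realSzegoSeries r 2 r := by
  have h1 : r ^ 2 < r := by nlinarith
  have h := (hasSum_realSzegoSeries hr hr1 h1 hr1 1).add (hasSum_realSzegoSeries hr hr1 h1 hr1 2)
  have h0 : 0 ≤ realSzegoSeries r 1 r + realSzegoSeries r 2 r := by
    refine h.nonneg fun n => ?_
    have hn : (0 : ℝ) ≤ (n : ℝ) + (n : ℝ) ^ 2 := by
      have : 0 ≤ n + n ^ 2 := by
        rcases lt_or_ge n 0 with h | h
        · nlinarith
        · positivity
      exact_mod_cast this
    have := szegoCoeff_pos hr n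
    have := zpow_pos hr n
    calc 0 ≤ ((n : ℝ) + (n : ℝ) ^ 2) * szegoCoeff r n * r ^ n := by positivity
      _ = _ := by ring
  rw [realSzegoSeries_one_self hr hr1] at h0
  linarith

/-! ### Wirtinger derivatives of radial functions -/

lemma dzbar_radial {H : ℝ → ℝ} {H' : ℝ} {z : ℂ} (h : HasDerivAt H H' (‖z‖ ^ 2)) :
    dzbar (fun w => ((H (‖w‖ ^ 2) : ℝ) : ℂ)) z = H' * z := by
  have h1 : HasFDerivAt (fun w : ℂ => ((H (‖w‖ ^ 2) : ℝ) : ℂ))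
      (Complex.ofRealCLM.comp (H' • (2 • innerSL ℝ z))) z :=
    Complex.ofRealCLM.hasFDerivAt.comp z
      (h.comp_hasFDerivAt z (hasStrictFDerivAt_norm_sq z).hasFDerivAt)
  rw [dzbar, h1.fderiv]
  apply Complex.ext <;> simp [Complex.inner] <;> ring

lemma dz_radial_mul {P : ℝ → ℝ} {P' : ℝ} {z : ℂ} (h : HasDerivAt P P' (‖z‖ ^ 2)) :
    dz (fun w => ((P (‖w‖ ^ 2) : ℝ) : ℂ) * w) z = ((P (‖z‖ ^ 2) + ‖z‖ ^ 2 * P' : ℝ) : ℂ) := by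
  have h1 : HasFDerivAt (fun w : ℂ => ((P (‖w‖ ^ 2) : ℝ) : ℂ))
      (Complex.ofRealCLM.comp (P' • (2 • innerSL ℝ z))) z :=
    Complex.ofRealCLM.hasFDerivAt.comp z
      (h.comp_hasFDerivAt z (hasStrictFDerivAt_norm_sq z).hasFDerivAt)
  have h2 : HasFDerivAt (fun w : ℂ => ((P (‖w‖ ^ 2) : ℝ) : ℂ) * w) _ z :=
    h1.mul (hasFDerivAt_id z)
  rw [dz, h2.fderiv, Complex.sq_norm, Complex.normSq_apply]
  apply Complex.ext <;> simp [Complex.inner] <;> ring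

lemma dz_congr {u v : ℂ → ℂ} {z : ℂ} (h : u =ᶠ[𝓝 z] v) : dz u z = dz v z := by
  rw [dz, dz, h.fderiv_eq]

lemma dzbar_congr {u v : ℂ → ℂ} {z : ℂ} (h : u =ᶠ[𝓝 z] v) : dzbar u z = dzbar v z := by
  rw [dzbar, dzbar, h.fderiv_eq]

/-- The Laplacian of a function that is radial near `z`. -/
lemma dz_dzbar_radial {u : ℂ → ℂ} {H P : ℝ → ℝ} {P' : ℝ} {z : ℂ} {V : Set ℂ} (hV : IsOpen V)
    (hz : z ∈ V) (hu : ∀ w ∈ V, u w = ((H (‖w‖ ^ 2) : ℝ) : ℂ))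
    (hH : ∀ w ∈ V, HasDerivAt H (P (‖w‖ ^ 2)) (‖w‖ ^ 2)) (hP : HasDerivAt P P' (‖z‖ ^ 2)) :
    dz (dzbar u) z = ((P (‖z‖ ^ 2) + ‖z‖ ^ 2 * P' : ℝ) : ℂ) := by
  rw [← dz_radial_mul hP]
  apply dz_congr
  filter_upwards [hV.mem_nhds hz] with w hw
  rw [← dzbar_radial (hH w hw)]
  exact dzbar_congr (eventually_of_mem (hV.mem_nhds hw) hu)

/-! ### Cauchy's formula and Laurent expansion in the annulus -/

lemma hasSum_circleAverage {ι : Type*} [Countable ι] {ρ : ℝ} (hρ : 0 ≤ ρ) {F : ι → ℂ → ℂ}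
    {f : ℂ → ℂ} {u : ι → ℝ} (hF : ∀ n, ContinuousOn (F n) (Metric.sphere 0 ρ))
    (hu : Summable u) (hle : ∀ n, ∀ ζ ∈ Metric.sphere (0 : ℂ) ρ, ‖F n ζ‖ ≤ u n)
    (hsum : ∀ ζ ∈ Metric.sphere (0 : ℂ) ρ, HasSum (fun n => F n ζ) (f ζ)) :
    HasSum (fun n => Real.circleAverage (F n) 0 ρ) (Real.circleAverage f 0 ρ) := by
  have hmem : ∀ θ, circleMap 0 ρ θ ∈ Metric.sphere (0 : ℂ) ρ := circleMap_mem_sphere 0 hρ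
  refine HasSum.const_smul _ ?_
  refine intervalIntegral.hasSum_integral_of_dominated_convergence (fun n _ => u n) ?_ ?_ ?_ ?_ ?_
  · intro n
    exact ((hF n).comp_continuous (continuous_circleMap 0 ρ) hmem).aestronglyMeasurable
  · exact fun n => ae_of_all _ fun θ _ => hle n _ (hmem θ)
  · exact ae_of_all _ fun _ _ => hu
  · exact intervalIntegrable_const
  · exact ae_of_all _ fun θ _ => hsum _ (hmem θ)

/-- A circle average of `g` is, up to a constant, the contour integral of `g z / z`, so Cauchy's
theorem applies. The exceptional set `s` allows for the removable point of a divided difference. -/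
lemma circleAverage_eq_of_annulus {r : ℝ} (hr : 0 < r) (hr1 : r < 1) {g : ℂ → ℂ} {s : Set ℂ}
    (hs : s.Countable) (hg : ContinuousOn g (closure (annulus r)))
    (hd : ∀ z ∈ annulus r \ s, DifferentiableAt ℂ g z) :
    Real.circleAverage g 0 1 = Real.circleAverage g 0 r := by
  have hcl : Metric.closedBall (0 : ℂ) 1 \ Metric.ball 0 r = closure (annulus r) := by
    rw [closure_annulus hr hr1]
    ext z
    simp [and_comm]
  rw [Real.circleAverage_eq_circleIntegral one_ne_zero,
    Real.circleAverage_eq_circleIntegral hr.ne',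
    Complex.circleIntegral_eq_of_differentiable_on_annulus_off_countable hr hr1.le hs]
  · rw [hcl]
    refine ((continuousOn_id.sub continuousOn_const).inv₀ ?_).smul hg
    rw [closure_annulus hr hr1]
    intro z hz
    change z - 0 ≠ 0
    rw [sub_zero]
    exact norm_pos_iff.1 (hr.trans_le hz.1)
  · rintro z ⟨⟨h1, h2⟩, h3⟩
    have h4 : z ∈ annulus r := ⟨by simpa using h2, by simpa using h1⟩
    have hz : z - (0 : ℂ) ≠ 0 := by
      rw [sub_zero]; exact norm_pos_iff.1 (hr.trans h4.1)
    exact ((differentiableAt_id.sub_const (0 : ℂ)).inv hz).smul (hd z ⟨h4, h3⟩)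

lemma sphere_one_subset {r : ℝ} (hr : 0 < r) (hr1 : r < 1) :
    Metric.sphere (0 : ℂ) 1 ⊆ closure (annulus r) :=
  subset_union_left.trans ((frontier_annulus hr hr1).symm.subset.trans frontier_subset_closure)

lemma sphere_subset {r : ℝ} (hr : 0 < r) (hr1 : r < 1) :
    Metric.sphere (0 : ℂ) r ⊆ closure (annulus r) :=
  subset_union_right.trans ((frontier_annulus hr hr1).symm.subset.trans frontier_subset_closure)

lemma ne_of_mem_frontier_annulus {r : ℝ} {w ζ : ℂ} (hw : w ∈ annulus r)
    (hζ : ζ ∈ frontier (annulus r)) : ζ - w ≠ 0 := by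
  rw [(isOpen_annulus r).frontier_eq] at hζ
  exact sub_ne_zero.2 fun h => hζ.2 (h ▸ hw)

/-- Cauchy's formula in an annulus. -/
lemma cauchy_annulus {r : ℝ} (hr : 0 < r) (hr1 : r < 1) {f : ℂ → ℂ}
    (hf : ContinuousOn f (closure (annulus r))) (hd : DifferentiableOn ℂ f (annulus r))
    {w : ℂ} (hw : w ∈ annulus r) :
    Real.circleAverage (fun ζ => ζ * f ζ / (ζ - w)) 0 1 -
      Real.circleAverage (fun ζ => ζ * f ζ / (ζ - w)) 0 r = f w := by
  have hA := isOpen_annulus r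
  have hS1 : Metric.sphere (0 : ℂ) 1 ⊆ frontier (annulus r) := by
    rw [frontier_annulus hr hr1]; exact subset_union_left
  have hSr : Metric.sphere (0 : ℂ) r ⊆ frontier (annulus r) := by
    rw [frontier_annulus hr hr1]; exact subset_union_right
  -- The averages of `ζ` times the divided difference agree on both circles. Splitting off `f w`
  -- leaves the winding number about `w`, which is 1 for the outer circle and 0 for the inner one.
  have hkey := circleAverage_eq_of_annulus hr hr1 (g := fun ζ => ζ * dslope f w ζ)
    (countable_singleton w)
    (continuousOn_id.mul ((continuousOn_dslope
      (mem_of_superset (hA.mem_nhds hw) subset_closure)).2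
        ⟨hf, hd.differentiableAt (hA.mem_nhds hw)⟩))
    (by
      rintro z ⟨hz, hzw⟩
      exact differentiableAt_id.mul ((differentiableAt_dslope_of_ne hzw).2
        (hd.differentiableAt (hA.mem_nhds hz))))
  have hone : ∀ ρ, Metric.sphere (0 : ℂ) ρ ⊆ frontier (annulus r) → 0 < ρ →
      Real.circleAverage (fun ζ => ζ * dslope f w ζ) 0 ρ =
        Real.circleAverage (fun ζ => ζ * f ζ / (ζ - w)) 0 ρ -
          f w * ((2 * Real.pi * Complex.I)⁻¹ • ∮ z in C(0, ρ), (z - w)⁻¹) := by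
    intro ρ hρ hρ0
    have hne : ∀ ζ ∈ Metric.sphere (0 : ℂ) ρ, ζ - w ≠ 0 := fun ζ hζ =>
      ne_of_mem_frontier_annulus hw (hρ hζ)
    have h1 : (2 * Real.pi * Complex.I)⁻¹ • ∮ z in C(0, ρ), (z - w)⁻¹ =
        Real.circleAverage (fun ζ => ζ / (ζ - w)) 0 ρ := by
      rw [Real.circleAverage_eq_circleIntegral hρ0.ne']
      congr 1
      refine circleIntegral.integral_congr hρ0.le fun z hz => ?_
      have hz0 : z ≠ 0 := norm_pos_iff.1 (by rw [mem_sphere_zero_iff_norm.1 hz]; exact hρ0)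
      simp only [sub_zero, smul_eq_mul]
      field_simp
    have h2 : f w * Real.circleAverage (fun ζ => ζ / (ζ - w)) 0 ρ =
        Real.circleAverage (fun ζ => f w * (ζ / (ζ - w))) 0 ρ := by
      simpa using (Real.circleAverage_fun_smul (a := f w) (f := fun ζ : ℂ => ζ / (ζ - w))
        (c := 0) (R := ρ)).symm
    rw [h1, h2, ← Real.circleAverage_fun_sub]
    · refine Real.circleAverage_congr_sphere fun ζ hζ => ?_
      rw [abs_of_pos hρ0] at hζ
      have := hne ζ hζ
      rw [dslope_of_ne _ (sub_ne_zero.1 this), slope_def_field]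
      field_simp
    · exact (ContinuousOn.div (continuousOn_id.mul
        (hf.mono (hρ.trans frontier_subset_closure))) (by fun_prop) hne).circleIntegrable hρ0.le
    · exact (continuousOn_const.mul (ContinuousOn.div continuousOn_id (by fun_prop)
        hne)).circleIntegrable hρ0.le
  have hI1 : ∮ z in C(0, 1), (z - w)⁻¹ = 2 * Real.pi * Complex.I :=
    circleIntegral.integral_sub_inv_of_mem_ball (by simpa using hw.2)
  have hIr : ∮ z in C(0, r), (z - w)⁻¹ = 0 := by
    have hne : ∀ z ∈ Metric.closedBall (0 : ℂ) r, z - w ≠ 0 := by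
      intro z hz h
      have : ‖z‖ ≤ r := by simpa using hz
      rw [sub_eq_zero.1 h] at this
      exact absurd hw.1 this.not_gt
    refine Complex.circleIntegral_eq_zero_of_differentiable_on_off_countable hr.le countable_empty
      (ContinuousOn.inv₀ (by fun_prop) hne) ?_
    rintro z ⟨hz, -⟩
    exact (differentiableAt_id.sub_const w).inv (hne z (Metric.ball_subset_closedBall hz))
  rw [hone 1 hS1 one_pos, hone r hSr hr, hI1, hIr, smul_eq_mul, inv_mul_cancel₀
    Complex.two_pi_I_ne_zero, mul_one, smul_zero, mul_zero, sub_zero] at hkey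
  rw [← hkey]
  ring

/-- The Laurent coefficients can be computed on either boundary circle. -/
lemma circleAverage_zpow_mul_eq {r : ℝ} (hr : 0 < r) (hr1 : r < 1) {f : ℂ → ℂ}
    (hf : ContinuousOn f (closure (annulus r))) (hd : DifferentiableOn ℂ f (annulus r)) (n : ℤ) :
    Real.circleAverage (fun ζ => ζ ^ n * f ζ) 0 1 =
      Real.circleAverage (fun ζ => ζ ^ n * f ζ) 0 r := by
  have hne : ∀ ζ ∈ closure (annulus r), ζ ≠ 0 := by
    rw [closure_annulus hr hr1]
    exact fun ζ hζ => norm_pos_iff.1 (hr.trans_le hζ.1)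
  refine circleAverage_eq_of_annulus hr hr1 countable_empty
    (ContinuousOn.mul (continuousOn_id.zpow₀ n fun z hz => Or.inl (hne z hz)) hf) ?_
  rintro z ⟨hz, -⟩
  exact (differentiableAt_zpow.2 (Or.inl (hne z (subset_closure hz)))).mul
    (hd.differentiableAt ((isOpen_annulus r).mem_nhds hz))

/-- The Laurent expansion in an annulus. -/
lemma hasSum_laurent_annulus {r : ℝ} (hr : 0 < r) (hr1 : r < 1) {f : ℂ → ℂ}
    (hf : ContinuousOn f (closure (annulus r))) (hd : DifferentiableOn ℂ f (annulus r))
    {w : ℂ} (hw : w ∈ annulus r) :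
    HasSum (fun n : ℤ => w ^ n * Real.circleAverage (fun ζ => ζ ^ (-n) * f ζ) 0 1) (f w) := by
  have hw0 : w ≠ 0 := norm_pos_iff.1 (hr.trans hw.1)
  have hind := circleAverage_zpow_mul_eq hr hr1 hf hd
  obtain ⟨B, hB⟩ : ∃ B, ∀ ζ ∈ closure (annulus r), ‖f ζ‖ ≤ B := by
    refine IsCompact.exists_bound_of_continuousOn ?_ hf
    exact (isSmoothlyBoundedDomain_annulus hr hr1).isBounded.isCompact_closure
  have hB0 : 0 ≤ B := (norm_nonneg _).trans (hB w (subset_closure hw))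
  have hsmul : ∀ (c : ℂ) (g : ℂ → ℂ) (ρ : ℝ),
      c * Real.circleAverage g 0 ρ = Real.circleAverage (fun ζ => c * g ζ) 0 ρ := fun c g ρ => by
    simpa using (Real.circleAverage_fun_smul (a := c) (f := g) (c := 0) (R := ρ)).symm
  rw [← cauchy_annulus hr hr1 hf hd hw, sub_eq_add_neg]
  -- Indices `n ≥ 0` come from the geometric series in `w / ζ` on the outer circle, indices `-(n +
  -- 1)` from the series in `ζ / w` on the inner circle, to which `hind` transfers the coefficients.
  refine HasSum.of_nat_of_neg_add_one ?_ ?_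
  · simp only [hsmul]
    refine hasSum_circleAverage zero_le_one (u := fun n => ‖w‖ ^ n * B) ?_ ?_ ?_ ?_
    · intro n
      refine continuousOn_const.mul (ContinuousOn.mul ?_ (hf.mono (sphere_one_subset hr hr1)))
      refine continuousOn_id.zpow₀ _ fun z hz => Or.inl ?_
      rintro rfl
      simp at hz
    · exact (summable_geometric_of_lt_one (norm_nonneg w) hw.2).mul_right B
    · intro n ζ hζ
      have h1 : ‖ζ‖ = 1 := by simpa using hζ
      simp only [zpow_natCast, zpow_neg, norm_mul, norm_pow, norm_inv, h1, one_pow, inv_one,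
        one_mul]
      gcongr
      exact hB ζ (sphere_one_subset hr hr1 hζ)
    · intro ζ hζ
      have h1 : ‖ζ‖ = 1 := by simpa using hζ
      have h0 : ζ ≠ 0 := norm_pos_iff.1 (by rw [h1]; exact one_pos)
      have h2 : ‖w / ζ‖ < 1 := by rw [norm_div, h1, div_one]; exact hw.2
      have h3 : ζ - w ≠ 0 := sub_ne_zero.2 (by rintro rfl; exact hw.2.ne h1)
      have h4 : ζ * f ζ / (ζ - w) = (1 - w / ζ)⁻¹ * f ζ := by
        rw [one_sub_div h0]
        field_simp
      rw [h4]
      refine ((hasSum_geometric_of_norm_lt_one h2).mul_right (f ζ)).congr_fun fun n => ?_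
      rw [zpow_natCast, zpow_neg, zpow_natCast, div_pow]
      ring
  · simp only [hind, hsmul]
    have hneg : -Real.circleAverage (fun ζ => ζ * f ζ / (ζ - w)) 0 r =
        Real.circleAverage (fun ζ => -1 * (ζ * f ζ / (ζ - w))) 0 r := by
      rw [← hsmul]; ring
    rw [hneg]
    have hwr : r / ‖w‖ < 1 := (div_lt_one (hr.trans hw.1)).2 hw.1
    refine hasSum_circleAverage hr.le (u := fun n => r / ‖w‖ * (r / ‖w‖) ^ n * B) ?_ ?_ ?_ ?_
    · intro n
      refine continuousOn_const.mul (ContinuousOn.mul ?_ (hf.mono (sphere_subset hr hr1)))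
      refine continuousOn_id.zpow₀ _ fun z hz => Or.inl ?_
      rintro rfl
      simp at hz
      exact hr.ne hz
    · exact ((summable_geometric_of_lt_one (by positivity) hwr).mul_left _).mul_right B
    · intro n ζ hζ
      have h1 : ‖ζ‖ = r := by simpa using hζ
      have h2 : ‖w ^ (-((n : ℤ) + 1)) * (ζ ^ (- -((n : ℤ) + 1)) * f ζ)‖ =
          r / ‖w‖ * (r / ‖w‖) ^ n * ‖f ζ‖ := by
        rw [neg_neg, ← Nat.cast_add_one, zpow_neg, zpow_natCast, zpow_natCast, norm_mul, norm_mul,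
          norm_inv, norm_pow, norm_pow, h1, ← pow_succ', div_pow]
        ring
      rw [h2]
      gcongr
      exact hB ζ (sphere_subset hr hr1 hζ)
    · intro ζ hζ
      have h1 : ‖ζ‖ = r := by simpa using hζ
      have h2 : ‖ζ / w‖ < 1 := by rwa [norm_div, h1]
      have h3 : w - ζ ≠ 0 := sub_ne_zero.2 (by rintro rfl; exact hw.1.ne h1.symm)
      have h4 : -1 * (ζ * f ζ / (ζ - w)) = ζ / w * f ζ * (1 - ζ / w)⁻¹ := by
        rw [one_sub_div hw0, ← neg_sub w ζ]
        field_simp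
      rw [h4]
      refine ((hasSum_geometric_of_norm_lt_one h2).mul_left (ζ / w * f ζ)).congr_fun fun n => ?_
      rw [neg_neg, ← Nat.cast_add_one, zpow_neg, zpow_natCast, zpow_natCast, div_pow]
      field_simp
      ring

/-! ### Identification of the Szegő kernel -/

/-- The Szegő kernel of the annulus `A_r`, as a Laurent series in `z * conj w`. -/
def annulusSzegoKernel (r : ℝ) (z w : ℂ) : ℂ :=
  (unitLength : ℂ)⁻¹ * szegoSeries r 0 (z * starRingEnd ℂ w)

lemma norm_mul_conj_mem {r : ℝ} (hr : 0 < r) {z w : ℂ} (hz : r ≤ ‖z‖ ∧ ‖z‖ ≤ 1)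
    (hw : w ∈ annulus r) :
    r ^ 2 < ‖z * starRingEnd ℂ w‖ ∧ ‖z * starRingEnd ℂ w‖ < 1 := by
  rw [norm_mul, RCLike.norm_conj]
  have h1 := hw.1
  have h2 := hw.2
  constructor
  · nlinarith [hz.1]
  · nlinarith [hz.2, norm_nonneg z]

/-- For fixed `w` inside the annulus, the series converges on an open neighbourhood of the closed
annulus. -/
lemma smoothHolomorphic_annulusSzegoKernel {r : ℝ} (hr : 0 < r) (hr1 : r < 1) {w : ℂ}
    (hw : w ∈ annulus r) :
    (fun z => annulusSzegoKernel r z w) ∈ smoothHolomorphic (annulus r) := by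
  set V : Set ℂ := {z | r ^ 2 < ‖z * starRingEnd ℂ w‖ ∧ ‖z * starRingEnd ℂ w‖ < 1} with hV
  have hcont : Continuous fun z : ℂ => ‖z * starRingEnd ℂ w‖ := by fun_prop
  have hVo : IsOpen V := (isOpen_lt continuous_const hcont).inter (isOpen_lt hcont continuous_const)
  have hsub : closure (annulus r) ⊆ V := by
    rw [closure_annulus hr hr1]
    exact fun z hz => norm_mul_conj_mem hr hz hw
  have hd : DifferentiableOn ℂ (fun z => annulusSzegoKernel r z w) V := by
    intro z hz
    refine (DifferentiableAt.const_mul ?_ _).differentiableWithinAt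
    exact (hasDerivAt_szegoSeries hr hr1 hz.1 hz.2 0).differentiableAt.comp z
      (differentiableAt_id.mul_const (starRingEnd ℂ w))
  exact ⟨hd.mono (subset_closure.trans hsub),
    (((hd.contDiffOn hVo).restrict_scalars ℝ).mono hsub)⟩

lemma memLp_of_mem_smoothHolomorphic {r : ℝ} (hr : 0 < r) (hr1 : r < 1) {f : ℂ → ℂ}
    (hf : f ∈ smoothHolomorphic (annulus r)) : MemLp f 2 (arcLength (annulus r)) := by
  have := isFiniteMeasure_arcLength hr hr1
  have hc : ContinuousOn f (frontier (annulus r)) := hf.2.continuousOn.mono frontier_subset_closure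
  obtain ⟨B, hB⟩ : ∃ B, ∀ ζ ∈ closure (annulus r), ‖f ζ‖ ≤ B :=
    (isSmoothlyBoundedDomain_annulus hr hr1).isBounded.isCompact_closure.exists_bound_of_continuousOn
      hf.2.continuousOn
  exact MemLp.of_bound (hc.aestronglyMeasurable isClosed_frontier.measurableSet) B
    ((ae_restrict_iff' isClosed_frontier.measurableSet).2
      (ae_of_all _ fun ζ hζ => hB ζ (frontier_subset_closure hζ)))

/-- The reproducing property of the kernel against functions that are smooth up to the boundary. -/
lemma annulusSzegoKernel_reproducing {r : ℝ} (hr : 0 < r) (hr1 : r < 1) {f : ℂ → ℂ}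
    (hf : f ∈ smoothHolomorphic (annulus r)) {w : ℂ} (hw : w ∈ annulus r) :
    ∫ ζ, starRingEnd ℂ (annulusSzegoKernel r ζ w) * f ζ ∂(arcLength (annulus r)) = f w := by
  have hw0 : w ≠ 0 := norm_pos_iff.1 (hr.trans hw.1)
  have hL : (unitLength : ℂ) ≠ 0 := by exact_mod_cast unitLength_pos.ne'
  have hS := smoothHolomorphic_annulusSzegoKernel hr hr1 hw
  have hfc : ContinuousOn f (closure (annulus r)) := hf.2.continuousOn
  have hprod : ContinuousOn (fun ζ => starRingEnd ℂ (annulusSzegoKernel r ζ w) * f ζ)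
      (frontier (annulus r)) :=
    (Complex.continuous_conj.comp_continuousOn
      (hS.2.continuousOn.mono frontier_subset_closure)).mul (hfc.mono frontier_subset_closure)
  rw [integral_arcLength hr hr1 hprod]
  obtain ⟨B, hB⟩ : ∃ B, ∀ ζ ∈ closure (annulus r), ‖f ζ‖ ≤ B :=
    (isSmoothlyBoundedDomain_annulus hr hr1).isBounded.isCompact_closure.exists_bound_of_continuousOn
      hfc
  have hsmul : ∀ (c : ℂ) (g : ℂ → ℂ) (ρ : ℝ),
      Real.circleAverage (fun ζ => c * g ζ) 0 ρ = c * Real.circleAverage g 0 ρ := fun c g ρ => by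
    simpa using Real.circleAverage_fun_smul (a := c) (f := g) (c := 0) (R := ρ)
  set a : ℤ → ℂ := fun n => Real.circleAverage (fun ζ => ζ ^ (-n) * f ζ) 0 1 with ha
  have hsum : ∀ ρ : ℝ, 0 < ρ → Metric.sphere (0 : ℂ) ρ ⊆ closure (annulus r) →
      (∀ n, a n = Real.circleAverage (fun ζ => ζ ^ (-n) * f ζ) 0 ρ) →
      HasSum (fun n : ℤ => (unitLength : ℂ)⁻¹ *
          (szegoCoeff r n * w ^ n * ((ρ : ℂ) ^ (2 * n) * a n)))
        (Real.circleAverage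
          (fun ζ => starRingEnd ℂ (annulusSzegoKernel r ζ w) * f ζ) 0 ρ) := by
    intro ρ hρ0 hρ hind
    have hne : ∀ ζ ∈ Metric.sphere (0 : ℂ) ρ, ζ ≠ 0 := fun ζ hζ =>
      norm_pos_iff.1 (by rw [mem_sphere_zero_iff_norm.1 hζ]; exact hρ0)
    have hbd : ∀ ζ ∈ Metric.sphere (0 : ℂ) ρ,
        r ^ 2 < ‖ζ * starRingEnd ℂ w‖ ∧ ‖ζ * starRingEnd ℂ w‖ < 1 := fun ζ hζ => by
      have := hρ hζ
      rw [closure_annulus hr hr1] at this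
      exact norm_mul_conj_mem hr this hw
    have hρmem : (ρ : ℂ) ∈ Metric.sphere (0 : ℂ) ρ := by simp [abs_of_pos hρ0]
    obtain ⟨σ, h3, h4, h5, h6⟩ := exists_radius hr.ne' (hbd _ hρmem).1 (hbd _ hρmem).2
    have hnorm : ∀ ζ ∈ Metric.sphere (0 : ℂ) ρ,
        ‖ζ * starRingEnd ℂ w‖ = ‖(ρ : ℂ) * starRingEnd ℂ w‖ := fun ζ hζ => by
      rw [norm_mul, norm_mul, mem_sphere_zero_iff_norm.1 hζ, mem_sphere_zero_iff_norm.1 hρmem]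
    have hcoef : ∀ n : ℤ, Real.circleAverage (fun ζ => starRingEnd ℂ
        ((unitLength : ℂ)⁻¹ * ((n : ℂ) ^ 0 * szegoCoeff r n * (ζ * starRingEnd ℂ w) ^ n)) * f ζ) 0 ρ
        = (unitLength : ℂ)⁻¹ * (szegoCoeff r n * w ^ n * ((ρ : ℂ) ^ (2 * n) * a n)) := by
      intro n
      rw [hind, ← hsmul, ← hsmul, ← hsmul]
      refine Real.circleAverage_congr_sphere fun ζ hζ => ?_
      rw [abs_of_pos hρ0] at hζ
      -- On this circle conjugation is inversion, so each term of the conjugated kernel picks out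
      -- one Laurent coefficient of `f`.
      have hconj : starRingEnd ℂ ζ = (ρ : ℂ) ^ 2 * ζ⁻¹ := by
        rw [eq_mul_inv_iff_mul_eq₀ (hne ζ hζ), mul_comm, Complex.mul_conj, Complex.normSq_eq_norm_sq,
          mem_sphere_zero_iff_norm.1 hζ]
        push_cast
        rfl
      simp only [map_mul, map_inv₀, map_zpow₀, Complex.conj_ofReal, Complex.conj_conj,
        hconj, mul_zpow, zpow_neg, inv_zpow, zpow_mul, pow_zero, one_mul]
      norm_cast
      ring
    simp_rw [← hcoef]
    refine hasSum_circleAverage hρ0.le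
      (u := fun n => ‖(unitLength : ℂ)⁻¹‖ * szegoMajorant r σ 0 n * B) ?_ ?_ ?_ ?_
    · intro n
      refine (Complex.continuous_conj.comp_continuousOn (continuousOn_const.mul
        (continuousOn_const.mul (ContinuousOn.zpow₀ (by fun_prop) n fun ζ hζ => Or.inl ?_)))).mul
          (hfc.mono hρ)
      exact mul_ne_zero (hne ζ hζ) ((map_ne_zero _).2 hw0)
    · exact ((summable_szegoMajorant r h3 h4 0).mul_left _).mul_right B
    · intro n ζ hζ
      rw [norm_mul, RCLike.norm_conj, norm_mul]
      have h7 := norm_szego_term_le hr hr1 h3 (t := ζ * starRingEnd ℂ w)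
        (by rw [hnorm ζ hζ]; exact h5.le) (by rw [hnorm ζ hζ]; exact h6.le) 0 n
      have h8 := (norm_nonneg _).trans h7
      gcongr
      exact hB ζ (hρ hζ)
    · intro ζ hζ
      have h7 := (hasSum_szegoSeries hr hr1 (hbd ζ hζ).1 (hbd ζ hζ).2 0).mul_left
        (unitLength : ℂ)⁻¹
      exact (Complex.hasSum_conj'.2 h7).mul_right (f ζ)
  have h1 := hsum 1 one_pos (sphere_one_subset hr hr1) fun _ => rfl
  have h2 := hsum r hr (sphere_subset hr hr1) fun n =>
    circleAverage_zpow_mul_eq hr hr1 hfc hf.1 (-n)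
  have h3 := (h1.add (h2.mul_left (r : ℂ))).mul_left (unitLength : ℂ)
  refine h3.unique ((hasSum_laurent_annulus hr hr1 hfc hf.1 hw).congr_fun fun n => ?_)
  -- The outer circle contributes `1` and the inner circle `r * r ^ (2 * n)`; the coefficient was
  -- chosen to cancel their sum.
  have hc : (szegoCoeff r n : ℂ) * (1 + (r : ℂ) * (r : ℂ) ^ (2 * n)) = 1 := by
    have : szegoCoeff r n * (1 + r * r ^ (2 * n)) = 1 := by
      rw [szegoCoeff, mul_comm r, ← zpow_add_one₀ hr.ne']
      exact inv_mul_cancel₀ (by positivity)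
    exact_mod_cast this
  simp only [Complex.ofReal_one, one_zpow, one_mul]
  calc _ = (unitLength : ℂ) * (unitLength : ℂ)⁻¹ *
        ((szegoCoeff r n : ℂ) * (1 + (r : ℂ) * (r : ℂ) ^ (2 * n))) * (w ^ n * a n) := by ring
    _ = _ := by rw [hc, mul_inv_cancel₀ hL, one_mul, one_mul]

/-- The kernel is smooth up to the boundary, so constant sequences exhibit its extension. For
general `h`, the reproducing formula passes to the limit: the inner products converge by `L²`
convergence, the values at `w` by local uniform convergence. -/
lemma isSzegoKernel_annulusSzegoKernel {r : ℝ} (hr : 0 < r) (hr1 : r < 1) :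
    IsSzegoKernel (annulus r) (annulusSzegoKernel r) where
  symm z _ w _ := by
    rw [annulusSzegoKernel, annulusSzegoKernel, map_mul, ← szegoSeries_conj, map_mul,
      Complex.conj_conj, map_inv₀, Complex.conj_ofReal, mul_comm z]
  reproducing w hw := by
    have hS := smoothHolomorphic_annulusSzegoKernel hr hr1 hw
    have hSm := memLp_of_mem_smoothHolomorphic hr hr1 hS
    refine ⟨hSm.toLp _, Submodule.le_topologicalClosure _ ⟨_, hS, hSm.coeFn_toLp⟩,
      ⟨hS.1, fun _ z => annulusSzegoKernel r z w, fun _ => hS, ?_, ?_⟩, ?_⟩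
    · refine tendsto_const_nhds.congr fun _ => (eLpNorm_eq_zero_of_ae_zero ?_).symm
      filter_upwards [hSm.coeFn_toLp] with ζ hζ
      rw [hζ, sub_self, Pi.zero_apply]
    · exact fun u hu x _ => ⟨univ, univ_mem, Eventually.of_forall fun _ _ _ =>
        refl_mem_uniformity hu⟩
    · rintro h - F ⟨-, f, hf, hfh, hfF⟩
      have hfm := fun n => memLp_of_mem_smoothHolomorphic hr hr1 (hf n)
      have hlim : Tendsto (fun n => (hfm n).toLp (f n)) atTop (𝓝 h) := by
        rw [Lp.tendsto_Lp_iff_tendsto_eLpNorm']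
        refine hfh.congr fun n => eLpNorm_congr_ae ?_
        filter_upwards [(hfm n).coeFn_toLp] with ζ hζ
        rw [Pi.sub_apply, hζ]
      have hinner : Tendsto (fun n => inner ℂ (hSm.toLp _) ((hfm n).toLp (f n))) atTop
          (𝓝 (inner ℂ (hSm.toLp _) h)) := tendsto_const_nhds.inner hlim
      have hval : ∀ n, inner ℂ (hSm.toLp _) ((hfm n).toLp (f n)) = f n w := by
        intro n
        rw [← annulusSzegoKernel_reproducing hr hr1 (hf n) hw, L2.inner_def]
        refine integral_congr_ae ?_
        filter_upwards [hSm.coeFn_toLp, (hfm n).coeFn_toLp] with ζ h1 h2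
        rw [h1, h2, RCLike.inner_apply, mul_comm]
      simp_rw [hval] at hinner
      rw [tendsto_nhds_unique (hfF.tendsto_at hw) hinner, L2.inner_def]
      simp_rw [RCLike.inner_apply, mul_comm]

/-- The Szegő kernel is unique. -/
lemma IsSzegoKernel.eq {Ω : Set ℂ} {S T : ℂ → ℂ → ℂ} (hS : IsSzegoKernel Ω S)
    (hT : IsSzegoKernel Ω T) {z w : ℂ} (hz : z ∈ Ω) (hw : w ∈ Ω) : S z w = T z w := by
  obtain ⟨k, hk, hkS, hkr⟩ := hS.reproducing w hw
  obtain ⟨l, hl, hlT, hlr⟩ := hT.reproducing z hz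
  -- Both sides equal the inner product of the two representatives: each kernel reproduces the
  -- other.
  rw [hlr k hk _ hkS, hT.symm z hz w hw, hkr l hl _ hlT, ← integral_conj]
  simp [mul_comm]

lemma szegoKernel_annulus {r : ℝ} (hr : 0 < r) (hr1 : r < 1) {z w : ℂ} (hz : z ∈ annulus r)
    (hw : w ∈ annulus r) : szegoKernel (annulus r) z w = annulusSzegoKernel r z w := by
  have h : ∃ S, IsSzegoKernel (annulus r) S := ⟨_, isSzegoKernel_annulusSzegoKernel hr hr1⟩
  rw [szegoKernel, dif_pos h]
  exact h.choose_spec.eq (isSzegoKernel_annulusSzegoKernel hr hr1) hz hw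

/-! ### The Szegő metric at `√r` and the comparison -/

lemma le_szegoMetric_annulus {r : ℝ} (hr : 0 < r) (hr1 : r < 1) :
    1 / (2 * √r) ≤ szegoMetric (annulus r) ((√r : ℝ) : ℂ) := by
  set p : ℂ := ((√r : ℝ) : ℂ) with hp
  have hpn : ‖p‖ ^ 2 = r := by
    rw [hp, Complex.norm_real, Real.norm_of_nonneg (Real.sqrt_nonneg r), Real.sq_sqrt hr.le]
  have hrange : ∀ w ∈ annulus r, r ^ 2 < ‖w‖ ^ 2 ∧ ‖w‖ ^ 2 < 1 := fun w hw =>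
    ⟨by have := hw.1; gcongr, (sq_lt_one_iff₀ (norm_nonneg w)).2 hw.2⟩
  have hr2 : r ^ 2 < r := by nlinarith
  set F := realSzegoSeries r with hF
  have hF0 : 0 < F 0 r := realSzegoSeries_zero_pos hr hr1 hr2 hr1
  have hu : ∀ w ∈ annulus r, ((Real.log (szegoKernel (annulus r) w w).re : ℝ) : ℂ) =
      ((Real.log (unitLength⁻¹ * F 0 (‖w‖ ^ 2)) : ℝ) : ℂ) := by
    intro w hw
    rw [szegoKernel_annulus hr hr1 hw hw, annulusSzegoKernel, Complex.mul_conj,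
      Complex.normSq_eq_norm_sq, ofReal_realSzegoSeries, ← Complex.ofReal_inv,
      ← Complex.ofReal_mul, Complex.ofReal_re]
  have hH : ∀ w ∈ annulus r, HasDerivAt (fun t => Real.log (unitLength⁻¹ * F 0 t))
      ((fun t => F 1 t / (t * F 0 t)) (‖w‖ ^ 2)) (‖w‖ ^ 2) := by
    intro w hw
    obtain ⟨h1, h2⟩ := hrange w hw
    have h3 := realSzegoSeries_zero_pos hr hr1 h1 h2
    have h4 := unitLength_pos
    have h5 := ((hasDerivAt_realSzegoSeries hr hr1 h1 h2 0).const_mul unitLength⁻¹).log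
      (by positivity)
    refine h5.congr_deriv ?_
    rw [zero_add, mul_div_mul_left _ _ (inv_ne_zero h4.ne'), div_div]
  have hP : HasDerivAt (fun t => F 1 t / (t * F 0 t))
      ((F 2 r / r * (r * F 0 r) - F 1 r * (1 * F 0 r + r * (F 1 r / r))) / (r * F 0 r) ^ 2)
      (‖p‖ ^ 2) := by
    rw [hpn]
    exact (hasDerivAt_realSzegoSeries hr hr1 hr2 hr1 1).div
      ((hasDerivAt_id r).mul (hasDerivAt_realSzegoSeries hr hr1 hr2 hr1 0)) (by positivity)
  have hkey := dz_dzbar_radial (isOpen_annulus r) (sqrt_mem_annulus hr hr1) hu hH hP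
  rw [szegoMetric, hkey, Complex.ofReal_re, hpn]
  have h1 : F 1 r = -F 0 r / 2 := realSzegoSeries_one_self hr hr1
  have h2 : F 0 r / 2 ≤ F 2 r := realSzegoSeries_two_self hr hr1
  have h3 : 1 / (4 * r) ≤ F 1 r / (r * F 0 r) + r * ((F 2 r / r * (r * F 0 r) -
      F 1 r * (1 * F 0 r + r * (F 1 r / r))) / (r * F 0 r) ^ 2) := by
    -- With mean `F 1 r / F 0 r = -1/2`, the left side is the variance `F 2 r / F 0 r - 1/4` divided
    -- by `r`.
    have h4 : F 1 r / (r * F 0 r) + r * ((F 2 r / r * (r * F 0 r) -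
        F 1 r * (1 * F 0 r + r * (F 1 r / r))) / (r * F 0 r) ^ 2) =
        (F 2 r / F 0 r - 1 / 4) / r := by
      rw [h1]
      field_simp
      ring
    have h5 : 1 / 2 ≤ F 2 r / F 0 r := by
      rw [le_div_iff₀ hF0]; linarith
    rw [h4, ← div_div]
    gcongr
    linarith
  refine Real.le_sqrt_of_sq_le ?_
  rw [div_pow, mul_pow, Real.sq_sqrt hr.le]
  norm_num at h3 ⊢
  exact h3

lemma le_szegoMetric_div_caratheodoryMetric {r : ℝ} (hr : 0 < r) (hr1 : r < 1) :
    -Real.log r / 4 ≤ szegoMetric (annulus r) ((√r : ℝ) : ℂ) /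
      caratheodoryMetric (annulus r) ((√r : ℝ) : ℂ) := by
  obtain ⟨hc, hc'⟩ := caratheodoryMetric_annulus_pos_and_le hr hr1
  have hs := le_szegoMetric_annulus hr hr1
  have hL : 0 < -Real.log r := neg_pos.2 (Real.log_neg hr hr1)
  have hsq : 0 < √r := Real.sqrt_pos.2 hr
  rw [le_div_iff₀ hc]
  generalize -Real.log r = L at *
  calc _ ≤ L / 4 * (2 / (√r * L)) := by gcongr
    _ = 1 / (2 * √r) := by field_simp; norm_num
    _ ≤ _ := hs

end Planar

end

theorem mainTheorem9 :
    (¬ ∃ M : ℝ, 0 < M ∧ ∀ Ω : Set ℂ, Planar.IsSmoothlyBoundedDomain Ω →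
      ∀ z ∈ Ω, Planar.szegoMetric Ω z / Planar.caratheodoryMetric Ω z ≤ M) ∧
    (∀ r : ℝ, 0 < r → r < 1 → Planar.IsSmoothlyBoundedDomain (Planar.annulus r)) ∧
    Tendsto
      (fun r : ℝ => Planar.szegoMetric (Planar.annulus r) ((√r : ℝ) : ℂ) /
        Planar.caratheodoryMetric (Planar.annulus r) ((√r : ℝ) : ℂ))
      (𝓝[>] 0) atTop := by
  have hmem : Ioo (0 : ℝ) 1 ∈ 𝓝[>] (0 : ℝ) := Ioo_mem_nhdsGT one_pos
  have hlim : Tendsto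
      (fun r : ℝ => Planar.szegoMetric (Planar.annulus r) ((√r : ℝ) : ℂ) /
        Planar.caratheodoryMetric (Planar.annulus r) ((√r : ℝ) : ℂ)) (𝓝[>] 0) atTop := by
    refine tendsto_atTop_mono' _ ?_
      ((tendsto_neg_atBot_atTop.comp Real.tendsto_log_nhdsGT_zero).atTop_div_const
        (by norm_num : (0 : ℝ) < 4))
    filter_upwards [hmem] with r hr
    exact Planar.le_szegoMetric_div_caratheodoryMetric hr.1 hr.2
  refine ⟨?_, fun r => Planar.isSmoothlyBoundedDomain_annulus, hlim⟩
  rintro ⟨M, -, hM⟩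
  obtain ⟨r, hr, hMr⟩ := ((eventually_of_mem hmem fun _ h => h).and
    (hlim.eventually_gt_atTop M)).exists
  exact (hM _ (Planar.isSmoothlyBoundedDomain_annulus hr.1 hr.2) _
    (Planar.sqrt_mem_annulus hr.1 hr.2)).not_gt hMr
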